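/- All graphs are finite and simple. A set $X$ of vertices of an $n$-vertex graph $G$ is a balanced separator if every connected component of $G-X$ has at most $2n/3$ vertices, and $s(G)$ denotes the minimum size of a balanced separator in $G$. For a class $\mathcal{H}$ of graphs and $n\in\mathbb{N}$, let $s_{\mathcal{H}}(n)=\max\{s(G): G\in\mathcal{H},\ |V(G)|\le n\}$ (with value $0$ if there is no such $G$). For a graph $G$ with $m$ vertices and $0<\varepsilon<1$, let $G^{\varepsilon}$ denote the graph obtained from $G$ by subdividing each edge $\lceil m^{\varepsilon/(1-\varepsilon)}\rceil$ times, and for a class $\mathcal{G}$ of graphs let $\mathcal{G}^{\varepsilon}$ denote the class of all graphs isomorphic to an induced subgraph of $G^{\varepsilon}$ for some $G\in\mathcal{G}$. Lemma. For every class $\mathcal{G}$ of graphs and every real $0<\varepsilon<1$, we have $s_{\mathcal{G}^{\varepsilon}}(n)=O(n^{1-\varepsilon})$ as $n\to\infty$. If, moreover, $\mathcal{G}$ contains all $3$-regular graphs (up to isomorphism), then $s_{\mathcal{G}^{\varepsilon}}(n)=\Omega(n^{1-\varepsilon})$, that is, there are $c>0$ and $n_0$ such that $s_{\mathcal{G}^{\varepsilon}}(n)\ge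 c\,n^{1-\varepsilon}$ for all $n\ge n_0$. -/

import Mathlib

open Filter Asymptotics

universe u

/-- A finite simple graph, bundled with its vertex set. -/
structure FinGraph : Type (u + 1) where
  V : Type u
  [finite : Finite V]
  graph : SimpleGraph V

attribute [instance] FinGraph.finite

namespace FinGraph

/-- The number of vertices. -/
noncomputable def order (G : FinGraph.{u}) : ℕ := Nat.card G.V

/-- `X` is a balanced separator of an `n`-vertex graph `G` if every connected component of `G - X`
has at most `2n/3` vertices. -/
def IsBalancedSeparator (G : FinGraph.{u}) (X : Set G.V) : Prop :=
  ∀ C : (G.graph.induce Xᶜ).ConnectedComponent, 3 * C.supp.ncard ≤ 2 * G.order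

/-- `s(G)`: the minimum size of a balanced separator in `G`. -/
noncomputable def sep (G : FinGraph.{u}) : ℕ :=
  sInf {k | ∃ X : Set G.V, G.IsBalancedSeparator X ∧ X.ncard = k}

theorem isBalancedSeparator_univ (G : FinGraph.{u}) : G.IsBalancedSeparator Set.univ := by
  intro C
  obtain ⟨⟨v, hv⟩, -⟩ := C.exists_rep
  exact absurd (Set.mem_univ v) hv

/-- The minimum defining `s(G)` is attained. -/
theorem exists_ncard_eq_sep (G : FinGraph.{u}) :
    ∃ X : Set G.V, G.IsBalancedSeparator X ∧ X.ncard = G.sep :=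
  Nat.sInf_mem (s := {k | ∃ X : Set G.V, G.IsBalancedSeparator X ∧ X.ncard = k})
    ⟨_, Set.univ, G.isBalancedSeparator_univ, rfl⟩

theorem sep_le_order (G : FinGraph.{u}) : G.sep ≤ G.order :=
  Nat.sInf_le ⟨Set.univ, G.isBalancedSeparator_univ, Set.ncard_univ _⟩

/-- `G` with each edge subdivided `k` times: the edge `e`, oriented arbitrarily from `a` to `b`
with `(a, b) = Quot.out e`, is replaced by the path `a, (e, 0), (e, 1), …, (e, k - 1), b`
(and is kept if `k = 0`). -/
noncomputable def subdivide (G : FinGraph.{u}) (k : ℕ) : FinGraph.{u} where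
  V := G.V ⊕ (G.graph.edgeSet × Fin k)
  graph := SimpleGraph.fromRel fun x y =>
    match x, y with
    | .inl a, .inl b => k = 0 ∧ G.graph.Adj a b
    | .inl a, .inr (e, i) =>
        ((i : ℕ) = 0 ∧ a = (Quot.out e.1).1) ∨ ((i : ℕ) + 1 = k ∧ a = (Quot.out e.1).2)
    | .inr (e, i), .inr (f, j) => e = f ∧ (i : ℕ) + 1 = (j : ℕ)
    | .inr _, .inl _ => False

/-- `G^ε`: every edge of the `m`-vertex graph `G` is subdivided `⌈m ^ (ε / (1 - ε))⌉` times. -/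
noncomputable def powSubdivide (G : FinGraph.{u}) (ε : ℝ) : FinGraph.{u} :=
  G.subdivide ⌈(G.order : ℝ) ^ (ε / (1 - ε))⌉₊

end FinGraph

/-- A class of finite graphs. -/
abbrev GraphClass : Type (u + 1) := Set FinGraph.{u}

namespace GraphClass

/-- `s_𝒢(n) = max {s(G) : G ∈ 𝒢, |V(G)| ≤ n}`, with the value `0` if there is no such `G`. -/
noncomputable def maxSep (𝒢 : GraphClass.{u}) (n : ℕ) : ℕ :=
  sSup {k | ∃ G ∈ 𝒢, G.order ≤ n ∧ G.sep = k}

/-- The supremum defining `s_𝒢(n)` is a maximum. -/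
theorem isGreatest_maxSep (𝒢 : GraphClass.{u}) (n : ℕ) (h : ∃ G ∈ 𝒢, G.order ≤ n) :
    IsGreatest {k | ∃ G ∈ 𝒢, G.order ≤ n ∧ G.sep = k} (maxSep 𝒢 n) := by
  have hb : BddAbove {k | ∃ G ∈ 𝒢, G.order ≤ n ∧ G.sep = k} := by
    refine ⟨n, ?_⟩
    rintro k ⟨G, -, hn, rfl⟩
    exact G.sep_le_order.trans hn
  obtain ⟨G, hG, hn⟩ := h
  exact ⟨Nat.sSup_mem ⟨_, G, hG, hn, rfl⟩ hb, fun k hk => le_csSup hb hk⟩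

/-- `𝒢^ε`: all graphs that are (isomorphic to) induced subgraphs of `G^ε` for some `G ∈ 𝒢`. -/
def powSubdivide (𝒢 : GraphClass.{u}) (ε : ℝ) : GraphClass.{u} :=
  {H | ∃ G ∈ 𝒢, H.graph.IsIndContained (G.powSubdivide ε).graph}

/-- `𝒢` contains all `3`-regular graphs (up to isomorphism). -/
def ContainsAllCubic (𝒢 : GraphClass.{u}) : Prop :=
  ∀ (V : Type u) [Fintype V] (H : SimpleGraph V) [H.LocallyFinite],
    H.IsRegularOfDegree 3 → ∃ G ∈ 𝒢, Nonempty (H ≃g G.graph)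

end GraphClass

/-!
# Separators in classes of subdivided graphs

*Upper bound.* Let `H` be an induced subgraph, on `n` vertices, of the graph obtained from an
`m`-vertex graph `G` by subdividing each edge `k` times. If one subdivided edge contains most of
`H`, three vertices separate `H` (`FinGraph.sep_le_three_of_large_pathPart`). Otherwise the branch
vertices form a balanced separator of size at most `m`
(`FinGraph.sep_le_order_of_small_pathPart`). Alternatively, it suffices to cut once each of the
`q ≤ n / k` subdivided edges that lie completely in `H`, and to delete at most one more vertex
(`FinGraph.sep_mul_le_of_small_pathPart`), because what remains after the cuts has at most one
branch vertex per component. As `k ≥ m ^ (ε / (1 - ε))`, one of `m` and `n / k` is at most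
`n ^ (1 - ε)`.

*Lower bound.* It suffices to have cubic graphs on `400 M` vertices whose subdivisions, for every
`k > 0`, need separators of size at least `M / 100`. A balanced separator of the subdivision
projects to a small set of vertices of the cubic graph that splits it into two large parts
(`FinGraph.le_sep_subdivide_of_expansion`), so cubic graphs with linear expansion for large sets
are needed. They are found by counting: take two families of `M` cycles of length `200`, called
blocks, and join them by a random perfect matching `π`. A small set leaves most blocks untouched,
and those are monochromatic; hence a bad cut yields sets `S`, `T` of blocks, with `S` not too small
and `T` not too large, such that `π` maps `S` into `T`. There are only `4 ^ M` pairs `(S, T)`, and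
each has exponentially small probability with a larger exponent, as the blocks are long
(`exists_perm_not_mapsTo_blocks`, `exists_blockGraph_expansion`).
-/

namespace FinGraph

/-! ### Separators from labellings -/

/-- If a labelling is constant along the edges of `G - X`, each component of `G - X` lies in one
fibre, so small fibres make `X` a balanced separator. -/
theorem isBalancedSeparator_of_labelling {G : FinGraph.{u}} {X : Set G.V} {ι : Type*}
    (φ : G.V → ι)
    (hφ : ∀ u v, G.graph.Adj u v → u ∉ X → v ∉ X → φ u = φ v)
    (hcard : ∀ l, 3 * {v | v ∉ X ∧ φ v = l}.ncard ≤ 2 * G.order) :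
    G.IsBalancedSeparator X := by
  intro C
  obtain ⟨v₀, rfl⟩ := C.exists_rep
  have hwalk : ∀ a b : ↥Xᶜ, (G.graph.induce Xᶜ).Walk a b → φ a = φ b := by
    intro a b w
    induction w with
    | nil => rfl
    | @cons u v _ h _ ih => exact (hφ _ _ h u.2 v.2).trans ih
  refine le_trans (Nat.mul_le_mul_left 3 ?_) (hcard (φ v₀))
  refine Set.ncard_le_ncard_of_injOn Subtype.val ?_ Subtype.val_injective.injOn
  intro w hw
  obtain ⟨p⟩ := SimpleGraph.ConnectedComponent.exact hw
  exact ⟨w.2, hwalk _ _ p⟩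

theorem sep_le_ncard {G : FinGraph.{u}} {X : Set G.V} (hX : G.IsBalancedSeparator X) :
    G.sep ≤ X.ncard :=
  Nat.sInf_le ⟨X, hX, rfl⟩

theorem ncard_le_order (G : FinGraph.{u}) (s : Set G.V) : s.ncard ≤ G.order :=
  Set.ncard_le_card s

theorem ncard_preimage_le {α β : Type*} [Finite β] {f : α → β} (hf : f.Injective) (s : Set β) :
    (f ⁻¹' s).ncard ≤ s.ncard :=
  Set.ncard_le_ncard_of_injOn f (fun _ h => h) hf.injOn

/-- A symmetric relation holds along all edges of a proper subdivision as soon as it holds along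
the two end edges and the inner edges of each subdivided edge. -/
theorem subdivide_adj_induction {G : FinGraph.{u}} {k : ℕ} (hk : 0 < k)
    {P : (G.subdivide k).V → (G.subdivide k).V → Prop} (hsymm : ∀ x y, P x y → P y x)
    (hfst : ∀ (e : G.graph.edgeSet) (i : Fin k), (i : ℕ) = 0 →
      P (.inl (Quot.out e.1).1) (.inr (e, i)))
    (hsnd : ∀ (e : G.graph.edgeSet) (i : Fin k), (i : ℕ) + 1 = k →
      P (.inl (Quot.out e.1).2) (.inr (e, i)))
    (hinner : ∀ (e : G.graph.edgeSet) (i j : Fin k), (i : ℕ) + 1 = j →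
      P (.inr (e, i)) (.inr (e, j)))
    {x y : (G.subdivide k).V} (h : (G.subdivide k).graph.Adj x y) : P x y := by
  have key : ∀ x y : G.V ⊕ (G.graph.edgeSet × Fin k), (match x, y with
    | .inl a, .inl b => k = 0 ∧ G.graph.Adj a b
    | .inl a, .inr (e, i) =>
        ((i : ℕ) = 0 ∧ a = (Quot.out e.1).1) ∨ ((i : ℕ) + 1 = k ∧ a = (Quot.out e.1).2)
    | .inr (e, i), .inr (f, j) => e = f ∧ (i : ℕ) + 1 = (j : ℕ)
    | .inr _, .inl _ => False) → P x y := by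
    rintro (a | ⟨e, i⟩) (b | ⟨f, j⟩) h
    · exact absurd h.1 hk.ne'
    · rcases h with ⟨h, rfl⟩ | ⟨h, rfl⟩
      · exact hfst _ _ h
      · exact hsnd _ _ h
    · exact h.elim
    · obtain ⟨rfl, h⟩ := h
      exact hinner _ _ _ h
  obtain ⟨-, h | h⟩ := (SimpleGraph.fromRel_adj _ _ _).1 h
  · exact key _ _ h
  · exact hsymm _ _ (key _ _ h)

/-- A median of a finite set with respect to an integer-valued function. -/
theorem exists_median {α : Type*} [Finite α] (S : Set α) (f : α → ℕ) {n : ℕ} (hS : S.ncard ≤ n) :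
    ∃ t, 2 * {y | y ∈ S ∧ f y < t}.ncard ≤ n ∧ 2 * {y | y ∈ S ∧ t < f y}.ncard ≤ n := by
  classical
  by_cases h : ∃ t, n ≤ 2 * {y | y ∈ S ∧ f y ≤ t}.ncard
  · refine ⟨Nat.find h, ?_, ?_⟩
    · rcases Nat.eq_zero_or_pos (Nat.find h) with h0 | h0
      · simp [h0]
      · have h1 := Nat.find_min h (Nat.sub_lt h0 one_pos)
        have h2 : {y | y ∈ S ∧ f y < Nat.find h} = {y | y ∈ S ∧ f y ≤ Nat.find h - 1} := by
          ext y
          have : f y < Nat.find h ↔ f y ≤ Nat.find h - 1 := by omega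
          simp only [Set.mem_ofPred_eq, this]
        rw [h2]
        omega
    · have h1 := Nat.find_spec h
      have h2 : {y | y ∈ S ∧ f y ≤ Nat.find h}.ncard + {y | y ∈ S ∧ Nat.find h < f y}.ncard
          ≤ S.ncard := by
        rw [← Set.ncard_union_eq]
        · exact Set.ncard_le_ncard (by rintro y (h | h) <;> exact h.1)
        · rw [Set.disjoint_left]
          rintro y h h'
          exact absurd h.2 (not_le.2 h'.2)
      omega
  · push Not at h
    obtain ⟨N, hN⟩ := (Set.finite_range f).bddAbove
    have h1 := h N
    have h2 : {y | y ∈ S ∧ f y ≤ N} = S := by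
      ext y
      exact ⟨fun h => h.1, fun h => ⟨h, hN ⟨y, rfl⟩⟩⟩
    rw [h2] at h1
    refine ⟨0, by simp, ?_⟩
    have : {y | y ∈ S ∧ 0 < f y}.ncard ≤ S.ncard := Set.ncard_le_ncard (fun y h => h.1)
    omega

/-! ### Separators of induced subgraphs of subdivisions -/

section Upper

variable {G H : FinGraph.{u}} {k : ℕ} (f : H.graph ↪g (G.subdivide k).graph)

/-- The vertices of `H` inside the subdivided edge `e`. -/
def pathPart (e : G.graph.edgeSet) : Set H.V := {y | ∃ i, f y = .inr (e, i)}

/-- The labelling criterion for an induced subgraph `H` of a subdivision: the separator and the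
labelling are given on the subdivision, only the fibres are counted in `H`. -/
theorem isBalancedSeparator_preimage (hk : 0 < k) {ι : Type*} (Y : Set (G.subdivide k).V)
    (φ : (G.subdivide k).V → ι)
    (hfst : ∀ (e : G.graph.edgeSet) (i : Fin k), (i : ℕ) = 0 → .inl (Quot.out e.1).1 ∉ Y →
      .inr (e, i) ∉ Y → φ (.inl (Quot.out e.1).1) = φ (.inr (e, i)))
    (hsnd : ∀ (e : G.graph.edgeSet) (i : Fin k), (i : ℕ) + 1 = k → .inl (Quot.out e.1).2 ∉ Y →
      .inr (e, i) ∉ Y → φ (.inl (Quot.out e.1).2) = φ (.inr (e, i)))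
    (hinner : ∀ (e : G.graph.edgeSet) (i j : Fin k), (i : ℕ) + 1 = j → .inr (e, i) ∉ Y →
      .inr (e, j) ∉ Y → φ (.inr (e, i)) = φ (.inr (e, j)))
    (hcard : ∀ l, 3 * {y | f y ∉ Y ∧ φ (f y) = l}.ncard ≤ 2 * H.order) :
    H.IsBalancedSeparator (f ⁻¹' Y) := by
  refine isBalancedSeparator_of_labelling (fun y => φ (f y)) ?_ hcard
  intro u v huv hu hv
  exact subdivide_adj_induction hk
    (P := fun x y => x ∉ Y → y ∉ Y → φ x = φ y) (fun x y h hx hy => (h hy hx).symm)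
    hfst hsnd hinner (f.map_adj_iff.2 huv) hu hv

/-- If a single subdivided edge contains more than `2/3` of the vertices of `H`, deleting its two
ends and the median of the vertices of `H` on it splits `H` into two halves of that edge and a rest
of less than `n/3` vertices. -/
theorem sep_le_three_of_large_pathPart (hk : 0 < k) (e₀ : G.graph.edgeSet)
    (he₀ : 2 * H.order < 3 * (pathPart f e₀).ncard) : H.sep ≤ 3 := by
  classical
  -- The position of a vertex on its subdivided edge.
  let pos : (G.subdivide k).V → ℕ := fun x => match x with
    | .inl _ => 0
    | .inr (_, i) => i
  obtain ⟨t, ht₁, ht₂⟩ := exists_median (pathPart f e₀) (fun y => pos (f y)) (H.ncard_le_order _)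
  let Y : Set (G.subdivide k).V :=
    {.inl (Quot.out e₀.1).1, .inl (Quot.out e₀.1).2} ∪
      {x | ∃ i : Fin k, (i : ℕ) = t ∧ x = .inr (e₀, i)}
  let φ : (G.subdivide k).V → Option Bool := fun x => match x with
    | .inl _ => none
    | .inr (e, i) => if e = e₀ then some (decide ((i : ℕ) < t)) else none
  have hY : Y.ncard ≤ 3 := by
    refine (Set.ncard_union_le _ _).trans ?_
    have h1 : ({.inl (Quot.out e₀.1).1, .inl (Quot.out e₀.1).2} :
        Set (G.subdivide k).V).ncard ≤ 2 :=
      (Set.ncard_insert_le _ _).trans (Nat.succ_le_succ (Set.ncard_singleton _).le)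
    have h2 : {x : (G.subdivide k).V | ∃ i : Fin k, (i : ℕ) = t ∧ x = .inr (e₀, i)}.ncard ≤ 1 := by
      rw [Set.ncard_le_one]
      rintro _ ⟨i, hi, rfl⟩ _ ⟨j, hj, rfl⟩
      have : i = j := Fin.ext (hi.trans hj.symm)
      rw [this]
    omega
  refine (sep_le_ncard (isBalancedSeparator_preimage f hk Y φ ?_ ?_ ?_ ?_)).trans
    ((ncard_preimage_le f.injective Y).trans hY)
  · intro e i hi h _
    by_cases he : e = e₀
    · subst he; exact absurd (Or.inl (Or.inl rfl)) h
    · simp [φ, he]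
  · intro e i hi h _
    by_cases he : e = e₀
    · subst he; exact absurd (Or.inl (Or.inr rfl)) h
    · simp [φ, he]
  · intro e i j hij hi hj
    by_cases he : e = e₀
    · subst he
      have hi' : (i : ℕ) ≠ t := fun h => hi (Or.inr ⟨i, h, rfl⟩)
      have hj' : (j : ℕ) ≠ t := fun h => hj (Or.inr ⟨j, h, rfl⟩)
      have : (i : ℕ) < t ↔ (j : ℕ) < t := by omega
      simp [φ, this]
    · simp [φ, he]
  · intro l
    rcases l with _ | _ | _
    · have h1 : {y | f y ∉ Y ∧ φ (f y) = none}.ncard ≤ (pathPart f e₀)ᶜ.ncard := by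
        refine Set.ncard_le_ncard ?_
        rintro y ⟨-, hy⟩ ⟨i, hi⟩
        simp [hi, φ] at hy
      have h2 := Set.ncard_add_ncard_compl (pathPart f e₀)
      have h3 : Nat.card H.V = H.order := rfl
      omega
    · have h1 : {y | f y ∉ Y ∧ φ (f y) = some false}.ncard
          ≤ {y | y ∈ pathPart f e₀ ∧ t < pos (f y)}.ncard := by
        refine Set.ncard_le_ncard ?_
        rintro y ⟨hyY, hy⟩
        rcases hfy : f y with a | ⟨e, i⟩
        · simp [hfy, φ] at hy
        · by_cases he : e = e₀
          · subst he
            simp only [hfy, φ, if_true, Option.some.injEq, decide_eq_false_iff_not, not_lt] at hy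
            have : (i : ℕ) ≠ t := fun h => hyY (Or.inr ⟨i, h, hfy⟩)
            refine ⟨⟨i, hfy⟩, ?_⟩
            simp only [hfy, pos]
            omega
          · simp [hfy, φ, he] at hy
      omega
    · have h1 : {y | f y ∉ Y ∧ φ (f y) = some true}.ncard
          ≤ {y | y ∈ pathPart f e₀ ∧ pos (f y) < t}.ncard := by
        refine Set.ncard_le_ncard ?_
        rintro y ⟨hyY, hy⟩
        rcases hfy : f y with a | ⟨e, i⟩
        · simp [hfy, φ] at hy
        · by_cases he : e = e₀
          · subst he
            simp only [hfy, φ, if_true, Option.some.injEq, decide_eq_true_eq] at hy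
            refine ⟨⟨i, hfy⟩, ?_⟩
            simpa only [hfy, pos] using hy
          · simp [hfy, φ, he] at hy
      omega

/-- Deleting all branch vertices leaves only pieces of single subdivided edges. -/
theorem sep_le_order_of_small_pathPart (hk : 0 < k)
    (hsmall : ∀ e, 3 * (pathPart f e).ncard ≤ 2 * H.order) : H.sep ≤ G.order := by
  let φ : (G.subdivide k).V → Option G.graph.edgeSet := fun x => match x with
    | .inl _ => none
    | .inr (e, _) => some e
  let Y : Set (G.subdivide k).V := Set.range Sum.inl
  have hY : Y.ncard = G.order := by
    rw [FinGraph.order, ← Nat.card_range_of_injective (f := (Sum.inl : G.V → (G.subdivide k).V))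
      Sum.inl_injective]
    rfl
  refine (sep_le_ncard (isBalancedSeparator_preimage f hk Y φ ?_ ?_ ?_ ?_)).trans
    ((ncard_preimage_le f.injective Y).trans hY.le)
  · exact fun e i _ h => absurd ⟨_, rfl⟩ h
  · exact fun e i _ h => absurd ⟨_, rfl⟩ h
  · exact fun e i j _ _ _ => rfl
  · rintro (_ | e)
    · have : {y | f y ∉ Y ∧ φ (f y) = none} = ∅ := by
        refine Set.eq_empty_of_forall_notMem ?_
        rintro y ⟨hyY, hy⟩
        rcases hfy : f y with a | ⟨e, i⟩
        · exact hyY ⟨a, hfy.symm⟩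
        · simp [hfy, φ] at hy
      simp [this]
    · refine le_trans (Nat.mul_le_mul_left 3 (Set.ncard_le_ncard ?_)) (hsmall e)
      rintro y ⟨-, hy⟩
      rcases hfy : f y with a | ⟨e', i⟩
      · simp [hfy, φ] at hy
      · simp only [hfy, φ, Option.some.injEq] at hy
        exact ⟨i, by rw [hfy, hy]⟩

/-- Deleting one inner vertex of each subdivided edge that lies completely in `H` leaves a graph
whose components contain at most one branch vertex each. If one of them is still too large, its
branch vertex is deleted as well, which leaves pieces of single subdivided edges. With `q` edges
completely in `H`, at most `q + 1` vertices are deleted. -/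
theorem sep_mul_le_of_small_pathPart (hk : 0 < k)
    (hsmall : ∀ e, 3 * (pathPart f e).ncard ≤ 2 * H.order) :
    ∃ q, H.sep ≤ q + 1 ∧ q * k ≤ H.order := by
  classical
  -- A cut position on each subdivided edge: a vertex missing from `H` if there is one.
  have hc : ∀ e : G.graph.edgeSet, ∃ i : Fin k,
      (∃ y, f y = .inr (e, i)) → ∀ j : Fin k, ∃ y, f y = .inr (e, j) := by
    intro e
    by_cases h : ∀ j : Fin k, ∃ y, f y = .inr (e, j)
    · exact ⟨⟨0, hk⟩, fun _ => h⟩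
    · push Not at h
      obtain ⟨j, hj⟩ := h
      exact ⟨j, fun ⟨y, hy⟩ => absurd hy (hj y)⟩
  choose c hc using hc
  -- The edges whose subdivision lies completely in `H`.
  let E : Set G.graph.edgeSet := {e | ∃ y, f y = .inr (e, c e)}
  let Y₀ : Set (G.subdivide k).V := {x | ∃ e, x = .inr (e, c e)}
  have hX₀ : (f ⁻¹' Y₀).ncard ≤ E.ncard := by
    let g : G.graph.edgeSet → (G.subdivide k).V := fun e => .inr (e, c e)
    refine (Set.ncard_le_ncard_of_injOn f (t := g '' E) ?_ f.injective.injOn).trans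
      (Set.ncard_image_le (s := E))
    rintro y ⟨e, he⟩
    exact ⟨e, ⟨y, he⟩, he.symm⟩
  have hE : E.ncard * k ≤ H.order := by
    have h : ∀ p : E × Fin k, ∃ y, f y = .inr (p.1.1, p.2) := fun p => hc _ p.1.2 p.2
    choose g hg using h
    have hinj : g.Injective := by
      intro p q hpq
      have h1 := (hg p).symm.trans ((congrArg f hpq).trans (hg q))
      have h2 := Prod.ext_iff.1 (Sum.inr_injective h1)
      exact Prod.ext (Subtype.ext h2.1) h2.2
    have h1 := Nat.card_le_card_of_injective g hinj
    rwa [Nat.card_prod, Nat.card_fin, Nat.card_coe_set_eq] at h1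
  -- The branch vertex to which a vertex remains attached once the cut positions are deleted.
  let lab : (G.subdivide k).V → G.V := fun x => match x with
    | .inl v => v
    | .inr (e, i) => if i < c e then (Quot.out e.1).1 else (Quot.out e.1).2
  have hlab_fst : ∀ (e : G.graph.edgeSet) (i : Fin k), (i : ℕ) = 0 → .inr (e, i) ∉ Y₀ →
      (Quot.out e.1).1 = lab (.inr (e, i)) := by
    intro e i hi h
    have h1 : i ≠ c e := fun h' => h ⟨e, by rw [h']⟩
    have h2 : i < c e := by
      have : (i : ℕ) ≠ c e := fun h => h1 (Fin.ext h)
      rw [Fin.lt_def]; omega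
    simp [lab, h2]
  have hlab_snd : ∀ (e : G.graph.edgeSet) (i : Fin k), (i : ℕ) + 1 = k → .inr (e, i) ∉ Y₀ →
      (Quot.out e.1).2 = lab (.inr (e, i)) := by
    intro e i hi h
    have h2 : ¬ i < c e := by
      have := (c e).2
      rw [Fin.lt_def]; omega
    simp [lab, h2]
  have hlab_inner : ∀ (e : G.graph.edgeSet) (i j : Fin k), (i : ℕ) + 1 = j → .inr (e, i) ∉ Y₀ →
      .inr (e, j) ∉ Y₀ → lab (.inr (e, i)) = lab (.inr (e, j)) := by
    intro e i j hij hi hj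
    have h1 : (i : ℕ) ≠ c e := fun h' => hi ⟨e, by rw [Fin.ext h']⟩
    have h2 : (j : ℕ) ≠ c e := fun h' => hj ⟨e, by rw [Fin.ext h']⟩
    have h3 : i < c e ↔ j < c e := by
      rw [Fin.lt_def, Fin.lt_def]; omega
    simp [lab, h3]
  refine ⟨E.ncard, ?_, hE⟩
  by_cases hfib : ∀ v, 3 * {y | lab (f y) = v}.ncard ≤ 2 * H.order
  · refine (sep_le_ncard (isBalancedSeparator_preimage f hk Y₀ lab ?_ ?_ hlab_inner ?_)).trans
      (hX₀.trans (Nat.le_succ _))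
    · exact fun e i hi _ h => hlab_fst e i hi h
    · exact fun e i hi _ h => hlab_snd e i hi h
    · intro v
      exact le_trans (Nat.mul_le_mul_left 3 (Set.ncard_le_ncard fun y h => h.2)) (hfib v)
  · push Not at hfib
    obtain ⟨v, hv⟩ := hfib
    -- The vertices not attached to `v` number less than `n/3` and share the label `none`.
    let φ : (G.subdivide k).V → Option G.graph.edgeSet := fun x =>
      if lab x = v then (match x with
        | .inl _ => none
        | .inr (e, _) => some e) else none
    let Y : Set (G.subdivide k).V := insert (.inl v) Y₀
    have hY : (f ⁻¹' Y).ncard ≤ E.ncard + 1 := by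
      have h1 : f ⁻¹' Y = f ⁻¹' {.inl v} ∪ f ⁻¹' Y₀ := rfl
      have h2 := Set.ncard_union_le (f ⁻¹' {.inl v}) (f ⁻¹' Y₀)
      have h3 := (ncard_preimage_le f.injective {.inl v}).trans (Set.ncard_singleton _).le
      rw [h1]
      omega
    refine (sep_le_ncard (isBalancedSeparator_preimage f hk Y φ ?_ ?_ ?_ ?_)).trans hY
    · intro e i hi h h'
      have h1 := hlab_fst e i hi (fun h => h' (Or.inr h))
      have h2 : (Quot.out e.1).1 ≠ v := fun h2 => h (Or.inl (by rw [h2]))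
      simp only [φ]
      rw [← h1, if_neg h2, if_neg h2]
    · intro e i hi h h'
      have h1 := hlab_snd e i hi (fun h => h' (Or.inr h))
      have h2 : (Quot.out e.1).2 ≠ v := fun h2 => h (Or.inl (by rw [h2]))
      simp only [φ]
      rw [← h1, if_neg h2, if_neg h2]
    · intro e i j hij hi hj
      have h1 := hlab_inner e i j hij (fun h => hi (Or.inr h)) (fun h => hj (Or.inr h))
      simp only [φ, h1]
    · rintro (_ | e)
      · have h1 : {y | f y ∉ Y ∧ φ (f y) = none}.ncard ≤ {y | lab (f y) = v}ᶜ.ncard := by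
          refine Set.ncard_le_ncard ?_
          rintro y ⟨hyY, hy⟩ hlv
          rw [Set.mem_ofPred_eq] at hlv
          rcases hfy : f y with a | ⟨e, i⟩
          · rw [hfy] at hlv hyY
            exact hyY (Or.inl (congrArg Sum.inl hlv))
          · rw [hfy] at hlv hy
            simp [φ, hlv] at hy
        have h2 := Set.ncard_add_ncard_compl {y | lab (f y) = v}
        have h3 : Nat.card H.V = H.order := rfl
        omega
      · refine le_trans (Nat.mul_le_mul_left 3 (Set.ncard_le_ncard ?_)) (hsmall e)
        rintro y ⟨-, hy⟩
        rcases hfy : f y with a | ⟨e', i⟩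
        · simp [hfy, φ] at hy
        · simp only [hfy, φ] at hy
          split_ifs at hy with h
          exact ⟨i, by rw [hfy, Option.some.inj hy]⟩

end Upper
end FinGraph

/-! ### A random permutation avoids block containments -/

section Perm

variable {α : Type*} [Fintype α] [DecidableEq α]

/-- The permutations mapping `A` into `B`. -/
def permsInto (A B : Finset α) : Finset (Equiv.Perm α) := {π | ∀ x ∈ A, π x ∈ B}

theorem mem_permsInto {A B : Finset α} {π : Equiv.Perm α} :
    π ∈ permsInto A B ↔ ∀ x ∈ A, π x ∈ B :=
  Finset.mem_filter_univ π

/-- Given that `A` is mapped into `B`, a further element is mapped into `B` with probability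
`(|B| - |A|) / (|α| - |A|) ≤ |B| / |α|`. -/
theorem card_permsInto_insert_mul_le {A B : Finset α} {x : α} (hx : x ∉ A)
    (hAB : A.card ≤ B.card) :
    (permsInto (insert x A) B).card * Fintype.card α ≤ B.card * (permsInto A B).card := by
  set N := Fintype.card α with hN
  have hBN : B.card ≤ N := Finset.card_le_univ B
  have hAN : A.card < N := by
    have := Finset.card_le_univ (insert x A)
    rw [Finset.card_insert_of_notMem hx] at this
    exact this
  -- By symmetry under transpositions, each `y ∉ A` is as likely as `x` to be mapped into `B`.
  have hsymm : ∀ y ∈ Aᶜ, ((permsInto A B).filter fun π => π y ∈ B).card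
      = (permsInto (insert x A) B).card := by
    intro y hy
    rw [Finset.mem_compl] at hy
    refine Finset.card_bij' (fun π _ => Equiv.swap x y |>.trans π)
      (fun π _ => Equiv.swap x y |>.trans π) ?_ ?_ ?_ ?_
    · intro π hπ
      simp only [Finset.mem_filter, mem_permsInto] at hπ ⊢
      intro z hz
      rcases Finset.mem_insert.1 hz with rfl | hz
      · simpa using hπ.2
      · have h1 : z ≠ x := fun h => hx (h ▸ hz)
        have h2 : z ≠ y := fun h => hy (h ▸ hz)
        simpa [Equiv.swap_apply_of_ne_of_ne h1 h2] using hπ.1 z hz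
    · intro π hπ
      simp only [Finset.mem_filter, mem_permsInto] at hπ ⊢
      refine ⟨fun z hz => ?_, by simpa using hπ x (Finset.mem_insert_self _ _)⟩
      have h1 : z ≠ x := fun h => hx (h ▸ hz)
      have h2 : z ≠ y := fun h => hy (h ▸ hz)
      simpa [Equiv.swap_apply_of_ne_of_ne h1 h2] using hπ z (Finset.mem_insert_of_mem hz)
    · intro π _; ext z; simp
    · intro π _; ext z; simp
  have hcount : ∀ π ∈ permsInto A B, (Aᶜ.filter fun y => π y ∈ B).card = B.card - A.card := by
    intro π hπ
    simp only [mem_permsInto] at hπ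
    have h1 : A.map π.toEmbedding ⊆ B := by
      intro z hz
      obtain ⟨w, hw, rfl⟩ := Finset.mem_map.1 hz
      exact hπ w hw
    have h2 : (Aᶜ.filter fun y => π y ∈ B).map π.toEmbedding = B \ A.map π.toEmbedding := by
      ext z
      obtain ⟨w, rfl⟩ := π.surjective z
      simp [and_comm]
    rw [← Finset.card_map π.toEmbedding, h2, Finset.card_sdiff_of_subset h1, Finset.card_map]
  have hdouble : (N - A.card) * (permsInto (insert x A) B).card
      = (B.card - A.card) * (permsInto A B).card := by
    have h1 : ∑ y ∈ Aᶜ, ((permsInto A B).filter fun π => π y ∈ B).card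
        = ∑ π ∈ permsInto A B, (Aᶜ.filter fun y => π y ∈ B).card :=
      by
      simp_rw [Finset.card_filter]
      exact Finset.sum_comm
    rw [Finset.sum_congr rfl hsymm, Finset.sum_congr rfl hcount, Finset.sum_const,
      Finset.sum_const, Finset.card_compl, smul_eq_mul, smul_eq_mul] at h1
    rw [h1, mul_comm]
  have h1 : 0 < N - A.card := Nat.sub_pos_of_lt hAN
  refine Nat.le_of_mul_le_mul_left ?_ h1
  have h2 : (B.card - A.card) * N ≤ (N - A.card) * B.card := by
    obtain ⟨b, hb⟩ := Nat.exists_eq_add_of_le hAB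
    obtain ⟨n, hn⟩ := Nat.exists_eq_add_of_le hBN
    rw [hn, hb, Nat.add_sub_cancel_left, add_assoc, Nat.add_sub_cancel_left]
    nlinarith
  calc (N - A.card) * ((permsInto (insert x A) B).card * N)
      = (B.card - A.card) * N * (permsInto A B).card := by rw [← mul_assoc, hdouble]; ring
    _ ≤ (N - A.card) * B.card * (permsInto A B).card := Nat.mul_le_mul_right _ h2
    _ = _ := by ring

/-- A random permutation maps `A` into `B` with probability at most `(|B| / |α|) ^ |A|`. -/
theorem card_permsInto_mul_le (A B : Finset α) :
    (permsInto A B).card * Fintype.card α ^ A.card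
      ≤ B.card ^ A.card * (Fintype.card α).factorial := by
  induction A using Finset.induction_on with
  | empty =>
    simpa using (Finset.card_le_univ (permsInto ∅ B)).trans_eq Fintype.card_perm
  | insert x A hx ih =>
    set N := Fintype.card α with hN
    rcases (permsInto A B).eq_empty_or_nonempty with h0 | ⟨π₀, hπ₀⟩
    · have : permsInto (insert x A) B = ∅ := by
        rw [← Finset.subset_empty, ← h0]
        intro π
        simp only [mem_permsInto]
        exact fun h y hy => h y (Finset.mem_insert_of_mem hy)
      simp [this]
    have hAB : A.card ≤ B.card := by
      simp only [mem_permsInto] at hπ₀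
      exact Finset.card_le_card_of_injOn π₀ hπ₀ π₀.injective.injOn
    have hstep := card_permsInto_insert_mul_le hx hAB
    rw [← hN] at hstep
    rw [Finset.card_insert_of_notMem hx]
    calc (permsInto (insert x A) B).card * N ^ (A.card + 1)
        = (permsInto (insert x A) B).card * N * N ^ A.card := by ring
      _ ≤ B.card * (permsInto A B).card * N ^ A.card := Nat.mul_le_mul_right _ hstep
      _ = B.card * ((permsInto A B).card * N ^ A.card) := by ring
      _ ≤ B.card * (B.card ^ A.card * N.factorial) := Nat.mul_le_mul_left _ ih
      _ = _ := by ring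

end Perm

/-- The vertices on one side: `M` blocks of `200` vertices each, every block a cycle. -/
abbrev BlockSide (M : ℕ) : Type := Fin M × ZMod 200

/-- Union bound over the at most `4 ^ M` pairs `(S, T)`: each is violated with probability at most
`(9/10) ^ (20 M)`, and `4 * (9/10) ^ 20 < 1`. The block length `200` is chosen for the last
inequality. -/
theorem exists_perm_not_mapsTo_blocks {M : ℕ} (hM : 0 < M) :
    ∃ π : Equiv.Perm (BlockSide M), ∀ S T : Finset (Fin M),
      M ≤ 10 * S.card → 10 * T.card ≤ 9 * M →
      ∃ x : BlockSide M, x.1 ∈ S ∧ (π x).1 ∉ T := by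
  classical
  by_contra! hcon
  let good : Finset (Finset (Fin M) × Finset (Fin M)) :=
    {p | M ≤ 10 * p.1.card ∧ 10 * p.2.card ≤ 9 * M}
  let bl : Finset (Fin M) → Finset (BlockSide M) := fun S => S ×ˢ Finset.univ
  have hbl : ∀ S, (bl S).card = S.card * 200 := fun S => by
    rw [Finset.card_product, Finset.card_univ, ZMod.card]
  have hN : Fintype.card (BlockSide M) = M * 200 := by
    rw [Fintype.card_prod, Fintype.card_fin, ZMod.card]
  set F : ℝ := ((M * 200).factorial : ℝ) with hF
  have hFpos : 0 < F := by positivity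
  have hMpos : (0 : ℝ) < M := by exact_mod_cast hM
  have hcover : (Finset.univ : Finset (Equiv.Perm (BlockSide M)))
      ⊆ good.biUnion fun p => permsInto (bl p.1) (bl p.2) := by
    intro π _
    obtain ⟨S, T, hS, hT, h⟩ := hcon π
    refine Finset.mem_biUnion.2 ⟨(S, T), by simp [good, hS, hT], ?_⟩
    simp only [mem_permsInto, bl, Finset.mem_product, Finset.mem_univ, and_true]
    exact h
  have hone : ∀ p ∈ good,
      ((permsInto (bl p.1) (bl p.2)).card : ℝ) ≤ (9 / 10 : ℝ) ^ (20 * M) * F := by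
    rintro ⟨S, T⟩ hp
    simp only [good, Finset.mem_filter_univ] at hp
    have h1 := card_permsInto_mul_le (bl S) (bl T)
    rw [hN, hbl, hbl] at h1
    have h2 : ((permsInto (bl S) (bl T)).card : ℝ) * ((M : ℝ) * 200) ^ (S.card * 200)
        ≤ ((T.card : ℝ) * 200) ^ (S.card * 200) * F := by
      rw [hF]; exact_mod_cast h1
    have h3 : ((T.card : ℝ) * 200) ≤ 9 / 10 * (M * 200) := by
      have : (10 * T.card : ℝ) ≤ 9 * M := by exact_mod_cast hp.2
      linarith
    have h4 : ((T.card : ℝ) * 200) ^ (S.card * 200)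
        ≤ (9 / 10 : ℝ) ^ (S.card * 200) * ((M : ℝ) * 200) ^ (S.card * 200) := by
      rw [← mul_pow]
      exact pow_le_pow_left₀ (by positivity) h3 _
    have h5 : (9 / 10 : ℝ) ^ (S.card * 200) ≤ (9 / 10 : ℝ) ^ (20 * M) :=
      pow_le_pow_of_le_one (by norm_num) (by norm_num) (by omega)
    have h6 : (0 : ℝ) < ((M : ℝ) * 200) ^ (S.card * 200) := by positivity
    refine le_of_mul_le_mul_right (h2.trans ?_) h6
    calc _ ≤ (9 / 10 : ℝ) ^ (S.card * 200) * ((M : ℝ) * 200) ^ (S.card * 200) * F := by gcongr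
      _ ≤ (9 / 10 : ℝ) ^ (20 * M) * ((M : ℝ) * 200) ^ (S.card * 200) * F := by gcongr
      _ = _ := by ring
  have hgood : (good.card : ℝ) ≤ 4 ^ M := by
    have h := Finset.card_le_univ good
    rw [Fintype.card_prod, Fintype.card_finset, Fintype.card_fin, ← mul_pow] at h
    exact_mod_cast h
  have htotal : F ≤ 4 ^ M * ((9 / 10 : ℝ) ^ (20 * M) * F) := by
    have h1 := (Finset.card_le_card hcover).trans Finset.card_biUnion_le
    rw [Finset.card_univ, Fintype.card_perm, hN] at h1
    calc F ≤ ∑ p ∈ good, ((permsInto (bl p.1) (bl p.2)).card : ℝ) := by rw [hF]; exact_mod_cast h1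
      _ ≤ ∑ p ∈ good, (9 / 10 : ℝ) ^ (20 * M) * F := Finset.sum_le_sum hone
      _ = good.card * ((9 / 10 : ℝ) ^ (20 * M) * F) := by rw [Finset.sum_const, nsmul_eq_mul]
      _ ≤ _ := by gcongr
  have hsmall : (4 : ℝ) ^ M * (9 / 10 : ℝ) ^ (20 * M) < 1 := by
    rw [pow_mul, ← mul_pow]
    exact pow_lt_one₀ (by positivity) (by norm_num) hM.ne'
  nlinarith

/-! ### Cubic graphs with linear expansion -/

/-- The graph in which `v` is joined to `s v`, `s⁻¹ v` and `t v`, for an involution `t`. -/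
def cycleMatchingGraph {V : Type*} (s t : Equiv.Perm V) (hs : ∀ v, s v ≠ v) (ht : ∀ v, t v ≠ v)
    (htt : ∀ v, t (t v) = v) : SimpleGraph V where
  Adj v w := w = s v ∨ v = s w ∨ w = t v
  symm := ⟨by
    rintro v w (h | h | rfl)
    · exact Or.inr (Or.inl h)
    · exact Or.inl h
    · exact Or.inr (Or.inr (htt v).symm)⟩
  loopless := ⟨by
    rintro v (h | h | h)
    · exact hs v h.symm
    · exact hs v h.symm
    · exact ht v h.symm⟩

theorem cycleMatchingGraph_isRegular {V : Type*} (s t : Equiv.Perm V) (hs : ∀ v, s v ≠ v)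
    (ht : ∀ v, t v ≠ v) (htt : ∀ v, t (t v) = v) (hss : ∀ v, s (s v) ≠ v) (hst : ∀ v, s v ≠ t v)
    (hst' : ∀ v, s (t v) ≠ v) [(cycleMatchingGraph s t hs ht htt).LocallyFinite] :
    (cycleMatchingGraph s t hs ht htt).IsRegularOfDegree 3 := by
  classical
  intro v
  have h : (cycleMatchingGraph s t hs ht htt).neighborFinset v = {s v, s.symm v, t v} := by
    ext w
    rw [SimpleGraph.mem_neighborFinset, Finset.mem_insert, Finset.mem_insert,
      Finset.mem_singleton, Equiv.eq_symm_apply, eq_comm (a := s w)]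
    rfl
  rw [← SimpleGraph.card_neighborFinset_eq_degree, h, Finset.card_eq_three]
  refine ⟨_, _, _, ?_, hst v, ?_, rfl⟩
  · rw [Ne, Equiv.eq_symm_apply]; exact hss v
  · rw [Ne, Equiv.symm_apply_eq]; exact (hst' v).symm

/-- The vertices on both sides; the Boolean tells the side. -/
abbrev BlockVertex (M : ℕ) : Type := Bool × BlockSide M

/-- The rotation of each block. -/
def blockShift (M : ℕ) : Equiv.Perm (BlockVertex M) :=
  Equiv.prodCongr (Equiv.refl _) (Equiv.prodCongr (Equiv.refl _) (Equiv.addRight 1))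

/-- The involution matching `x` on the first side with `π x` on the second. -/
def sideMatching {M : ℕ} (π : Equiv.Perm (BlockSide M)) : Equiv.Perm (BlockVertex M) where
  toFun v := match v with
    | (false, x) => (true, π x)
    | (true, x) => (false, π.symm x)
  invFun v := match v with
    | (false, x) => (true, π x)
    | (true, x) => (false, π.symm x)
  left_inv := by rintro ⟨_ | _, x⟩ <;> simp
  right_inv := by rintro ⟨_ | _, x⟩ <;> simp

theorem sideMatching_sideMatching {M : ℕ} (π : Equiv.Perm (BlockSide M)) (v : BlockVertex M) :
    sideMatching π (sideMatching π v) = v := (sideMatching π).left_inv v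

theorem sideMatching_fst {M : ℕ} (π : Equiv.Perm (BlockSide M)) (v : BlockVertex M) :
    (sideMatching π v).1 = !v.1 := by
  obtain ⟨_ | _, x⟩ := v <;> rfl

theorem blockShift_ne {M : ℕ} (v : BlockVertex M) : blockShift M v ≠ v := by
  intro h
  have h1 : v.2.2 + 1 = v.2.2 := congrArg (fun w : BlockVertex M => w.2.2) h
  exact absurd (add_eq_left.1 h1) (by decide)

theorem blockShift_blockShift_ne {M : ℕ} (v : BlockVertex M) :
    blockShift M (blockShift M v) ≠ v := by
  intro h
  have h1 : v.2.2 + 1 + 1 = v.2.2 := congrArg (fun w : BlockVertex M => w.2.2) h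
  rw [add_assoc] at h1
  exact absurd (add_eq_left.1 h1) (by decide)

theorem sideMatching_ne {M : ℕ} (π : Equiv.Perm (BlockSide M)) {v w : BlockVertex M}
    (h : w.1 = v.1) : sideMatching π v ≠ w := by
  intro h'
  have h1 := sideMatching_fst π v
  rw [h', h] at h1
  cases hv : v.1 <;> simp [hv] at h1

/-- Two families of `M` cycles of length `200`, joined by the matching given by `π`. -/
def blockGraph {M : ℕ} (π : Equiv.Perm (BlockSide M)) : SimpleGraph (BlockVertex M) :=
  cycleMatchingGraph (blockShift M) (sideMatching π) blockShift_ne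
    (fun _ => sideMatching_ne π rfl) (sideMatching_sideMatching π)

theorem blockGraph_isRegular {M : ℕ} (π : Equiv.Perm (BlockSide M))
    [(blockGraph π).LocallyFinite] :
    (blockGraph π).IsRegularOfDegree 3 := by
  unfold blockGraph at *
  refine cycleMatchingGraph_isRegular _ _ _ _ _ blockShift_blockShift_ne
    (fun v => (sideMatching_ne π (v := v) (w := blockShift M v) rfl).symm) (fun v h => ?_)
  exact sideMatching_ne π (v := v) (w := (blockShift M).symm v) rfl ((Equiv.eq_symm_apply _).2 h)

/-- Expansion for large sets, in a graph with `400 * M` vertices: if a two-colouring is constant on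
the edges that avoid a set `U` of at most `x` vertices, and both colour classes have at least
`400 * M / 6 - 2 * x` vertices, then `x ≥ M / 100`. -/
def HasLargeSetExpansion {V : Type*} (G : SimpleGraph V) (M : ℕ) : Prop :=
  ∀ (U : Set V) (c : V → Bool) (x : ℕ), U.ncard ≤ x →
    (∀ u v, G.Adj u v → u ∉ U → v ∉ U → c u = c v) →
    (∀ b, 400 * M ≤ 6 * {v | c v = b}.ncard + 12 * x) → M ≤ 100 * x

/-- If `U` has fewer than `M/100` vertices, almost all blocks avoid it and are monochromatic. Then
for some colour `b`, a tenth of the blocks on the first side have colour `b` and a tenth of those on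
the second side have the other colour; no matching edge joins the former to the latter, contrary to
the choice of `π`. -/
theorem exists_blockGraph_expansion {M : ℕ} (hM : 0 < M) :
    ∃ π : Equiv.Perm (BlockSide M), HasLargeSetExpansion (blockGraph π) M := by
  classical
  obtain ⟨π, hπ⟩ := exists_perm_not_mapsTo_blocks hM
  refine ⟨π, fun U c x hUx hc hbig => ?_⟩
  by_contra! hU
  -- The blocks meeting `U`; all others are monochromatic.
  let dirty : Finset (Bool × Fin M) := {p | ∃ j, (p.1, p.2, j) ∈ U}
  have hdirty : dirty.card ≤ U.ncard := by
    have h1 : (dirty : Set (Bool × Fin M)) ⊆ (fun v : BlockVertex M => (v.1, v.2.1)) '' U := by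
      rintro ⟨a, i⟩ h
      simp only [dirty, Finset.coe_filter_univ, Set.mem_ofPred_eq] at h
      obtain ⟨j, hj⟩ := h
      exact ⟨_, hj, rfl⟩
    rw [← Set.ncard_coe_finset]
    exact (Set.ncard_le_ncard h1).trans Set.ncard_image_le
  have hmono : ∀ a i, (a, i) ∉ dirty → ∀ j, c (a, i, j) = c (a, i, 0) := by
    intro a i hai j
    simp only [dirty, Finset.mem_filter_univ, not_exists] at hai
    obtain ⟨n, rfl⟩ := ZMod.natCast_zmod_surjective j
    induction n with
    | zero => simp
    | succ n ih =>
      rw [← ih]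
      push_cast
      exact (hc (a, i, (n : ZMod 200)) _ (Or.inl rfl) (hai _) (hai _)).symm
  -- The blocks of colour `b` on side `a` that avoid `U`.
  let P : Bool → Bool → Finset (Fin M) := fun b a => {i | (a, i) ∉ dirty ∧ c (a, i, 0) = b}
  have hcross : ∀ b, ¬ (M ≤ 10 * (P b false).card ∧ M ≤ 10 * (P (!b) true).card) := by
    rintro b ⟨h1, h2⟩
    obtain ⟨⟨i, j⟩, hx, hy⟩ := hπ (P b false) (P (!b) true)ᶜ h1 (by
      rw [Finset.card_compl, Fintype.card_fin]; omega)
    rw [Finset.mem_compl, not_not] at hy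
    obtain ⟨i', j', hij⟩ : ∃ i' j', π (i, j) = (i', j') := ⟨_, _, rfl⟩
    rw [hij] at hy
    simp only [P, Finset.mem_filter_univ] at hx hy
    have h3 : c (false, i, j) = c (true, i', j') := by
      refine hc _ _ (Or.inr (Or.inr ?_)) ?_ ?_
      · show _ = (true, π (i, j))
        rw [hij]
      · intro h; exact hx.1 (by simp only [dirty, Finset.mem_filter_univ]; exact ⟨_, h⟩)
      · intro h; exact hy.1 (by simp only [dirty, Finset.mem_filter_univ]; exact ⟨_, h⟩)
    rw [hmono _ _ hx.1, hmono _ _ hy.1, hx.2, hy.2] at h3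
    cases b <;> simp at h3
  have hside : ∀ a, M ≤ (P true a).card + (P false a).card + U.ncard := by
    intro a
    have h1 : (Finset.univ : Finset (Fin M)) ⊆ P true a ∪ P false a ∪
        dirty.image Prod.snd := by
      intro i _
      by_cases h : (a, i) ∈ dirty
      · exact Finset.mem_union_right _ (Finset.mem_image.2 ⟨_, h, rfl⟩)
      · refine Finset.mem_union_left _ ?_
        cases hcol : c (a, i, 0)
        · exact Finset.mem_union_right _ (by simp [P, h, hcol])
        · exact Finset.mem_union_left _ (by simp [P, h, hcol])
    have h2 := Finset.card_le_card h1
    rw [Finset.card_univ, Fintype.card_fin] at h2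
    have h3 := Finset.card_union_le (P true a ∪ P false a) (dirty.image Prod.snd)
    have h4 := Finset.card_union_le (P true a) (P false a)
    have h5 : (dirty.image Prod.snd).card ≤ dirty.card := Finset.card_image_le
    omega
  have hcol : ∀ b, {v | c v = b}.ncard ≤ 200 * ((P b true).card + (P b false).card + U.ncard) := by
    intro b
    let Q : Finset (Bool × Fin M) := {true} ×ˢ P b true ∪ {false} ×ˢ P b false ∪ dirty
    have h1 : {v | c v = b} ⊆ ((Q ×ˢ Finset.univ).image
        (fun p : (Bool × Fin M) × ZMod 200 => ((p.1.1, p.1.2, p.2) : BlockVertex M)) :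
          Set (BlockVertex M)) := by
      rintro ⟨a, i, j⟩ h
      rw [Set.mem_ofPred_eq] at h
      refine Finset.mem_coe.2 (Finset.mem_image.2 ⟨((a, i), j), ?_, rfl⟩)
      refine Finset.mem_product.2 ⟨?_, Finset.mem_univ _⟩
      by_cases hd : (a, i) ∈ dirty
      · exact Finset.mem_union_right _ hd
      · rw [hmono _ _ hd] at h
        refine Finset.mem_union_left _ ?_
        cases a
        · exact Finset.mem_union_right _ (by simp [P, hd, h])
        · exact Finset.mem_union_left _ (by simp [P, hd, h])
    have h2 := Set.ncard_le_ncard h1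
    rw [Set.ncard_coe_finset] at h2
    have h3 := h2.trans Finset.card_image_le
    rw [Finset.card_product, Finset.card_univ, ZMod.card] at h3
    have h4 := Finset.card_union_le ({true} ×ˢ P b true ∪ {false} ×ˢ P b false) dirty
    have h5 := Finset.card_union_le ({true} ×ˢ P b true) ({false} ×ˢ P b false)
    rw [Finset.card_product, Finset.card_product, Finset.card_singleton,
      Finset.card_singleton] at h5
    have h7 : Q = {true} ×ˢ P b true ∪ {false} ×ˢ P b false ∪ dirty := rfl
    rw [← h7] at h4
    have h6 : Q.card ≤ (P b true).card + (P b false).card + U.ncard := by omega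
    omega
  have := hcross true
  have := hcross false
  have := hside true
  have := hside false
  have := hcol true
  have := hcol false
  have := hbig true
  have := hbig false
  simp only [Bool.not_true, Bool.not_false] at *
  omega

/-! ### Two-colourings from balanced separators -/

/-- Weights of total `n - x`, each at most `2n/3`, split into two groups of at least `n/3 - x`. -/
theorem exists_balanced_split {ι : Type*} [Fintype ι] [DecidableEq ι] (w : ι → ℕ) {n x : ℕ}
    (hw : ∀ i, 3 * w i ≤ 2 * n) (hx : ∑ i, w i + x = n) :
    ∃ I : Finset ι, n ≤ 3 * (∑ i ∈ I, w i + x) ∧ n ≤ 3 * (∑ i ∈ Iᶜ, w i + x) := by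
  by_cases hT : 3 * ∑ i, w i < n
  · exact ⟨∅, by omega, by omega⟩
  -- A group of weight at least `n/3` with as few members as possible has weight at most `2n/3`.
  obtain ⟨I, hI, hmin⟩ := Finset.exists_min_image
    (Finset.univ.filter fun I : Finset ι => n ≤ 3 * ∑ i ∈ I, w i) Finset.card
    ⟨Finset.univ, by simpa using hT⟩
  rw [Finset.mem_filter_univ] at hI
  have hle : 3 * ∑ i ∈ I, w i ≤ 2 * n := by
    rcases I.eq_empty_or_nonempty with rfl | ⟨i, hi⟩
    · simp
    by_cases h : n ≤ 3 * ∑ j ∈ I.erase i, w j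
    · have h1 := hmin _ ((Finset.mem_filter_univ _).2 h)
      have h2 := Finset.card_erase_lt_of_mem hi
      omega
    · have h1 := Finset.add_sum_erase I w hi
      by_cases h2 : n ≤ 3 * w i
      · have h3 := hmin {i} ((Finset.mem_filter_univ _).2 (by simpa using h2))
        rw [Finset.card_singleton] at h3
        have h4 : {i} = I := Finset.eq_of_subset_of_card_le (Finset.singleton_subset_iff.2 hi) h3
        rw [← h4, Finset.sum_singleton]
        exact hw i
      · omega
  refine ⟨I, by omega, ?_⟩
  have := Finset.sum_add_sum_compl I w
  omega

namespace FinGraph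

/-- The components of `G - X` can be distributed over two colours so that each colour class,
together with `X`, has at least a third of the vertices. -/
theorem IsBalancedSeparator.exists_coloring {G : FinGraph.{u}} {X : Set G.V}
    (hX : G.IsBalancedSeparator X) :
    ∃ γ : G.V → Bool, (∀ u v, G.graph.Adj u v → u ∉ X → v ∉ X → γ u = γ v) ∧
      ∀ b, G.order ≤ 3 * ({v | v ∉ X ∧ γ v = b}.ncard + X.ncard) := by
  classical
  let K := (G.graph.induce Xᶜ).ConnectedComponent
  let comp : ↥Xᶜ → K := (G.graph.induce Xᶜ).connectedComponentMk
  have : Fintype ↥Xᶜ := Fintype.ofFinite _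
  have : Fintype K := Fintype.ofFinite _
  have hsum : ∀ I : Finset K, ∑ C ∈ I, C.supp.ncard = {v : ↥Xᶜ | comp v ∈ I}.ncard := by
    intro I
    have h1 := Finset.card_eq_sum_card_fiberwise (f := comp)
      (s := Finset.univ.filter fun v => comp v ∈ I) (t := I) (fun v hv => by simpa using hv)
    have h2 : {v : ↥Xᶜ | comp v ∈ I} = ((Finset.univ.filter fun v => comp v ∈ I : Finset _) :
      Set ↥Xᶜ) := by ext; simp
    rw [h2, Set.ncard_coe_finset, h1]
    refine Finset.sum_congr rfl fun C hC => ?_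
    rw [← Set.ncard_coe_finset]
    congr 1
    ext v
    simp only [Finset.coe_filter, Finset.mem_filter_univ, Set.mem_ofPred_eq,
      SimpleGraph.ConnectedComponent.mem_supp_iff]
    exact ⟨fun h => ⟨by rw [← h] at hC; exact hC, h⟩, fun h => h.2⟩
  have htot : ∑ C : K, C.supp.ncard + X.ncard = G.order := by
    have h1 : {v : ↥Xᶜ | comp v ∈ Finset.univ} = Set.univ := by ext; simp
    rw [hsum, h1, Set.ncard_univ, Nat.card_coe_set_eq, add_comm, Set.ncard_add_ncard_compl]
    rfl
  obtain ⟨I, hI, hI'⟩ := exists_balanced_split (fun C : K => C.supp.ncard) hX htot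
  refine ⟨fun v => if h : v ∈ Xᶜ then decide (comp ⟨v, h⟩ ∈ I) else false, ?_, ?_⟩
  · intro u v huv hu hv
    have h : comp ⟨u, hu⟩ = comp ⟨v, hv⟩ := by
      refine SimpleGraph.ConnectedComponent.sound (SimpleGraph.Adj.reachable ?_)
      exact huv
    simp only [dif_pos (show u ∈ Xᶜ from hu), dif_pos (show v ∈ Xᶜ from hv), h]
  · have key : ∀ (J : Finset K) (b : Bool), (∀ C, C ∈ J ↔ decide (C ∈ I) = b) →
        ∑ C ∈ J, C.supp.ncard ≤ {v | v ∉ X ∧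
          (if h : v ∈ Xᶜ then decide (comp ⟨v, h⟩ ∈ I) else false) = b}.ncard := by
      intro J b hJ
      rw [hsum]
      refine Set.ncard_le_ncard_of_injOn Subtype.val ?_ Subtype.val_injective.injOn
      intro v hv
      refine ⟨v.2, ?_⟩
      rw [dif_pos v.2]
      exact (hJ _).1 hv
    rintro (_ | _)
    · exact hI'.trans (by gcongr; exact key _ _ (by simp))
    · exact hI.trans (by gcongr; exact key _ _ (by simp))

/-! ### Separators of subdivided cubic graphs -/

section Cubic

variable {G : FinGraph.{u}} {k : ℕ}

/-- Each inner vertex of a subdivided edge is assigned to the first end of that edge. -/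
noncomputable def basePoint (G : FinGraph.{u}) (k : ℕ) : (G.subdivide k).V → G.V
  | .inl v => v
  | .inr (e, _) => (Quot.out e.1).1

theorem two_mul_order_subdivide [Fintype G.V] [G.graph.LocallyFinite]
    (hreg : G.graph.IsRegularOfDegree 3) : 2 * (G.subdivide k).order = G.order * (2 + 3 * k) := by
  classical
  have h1 : (G.subdivide k).order = G.order + Nat.card G.graph.edgeSet * k := by
    have : (G.subdivide k).order = Nat.card (G.V ⊕ (G.graph.edgeSet × Fin k)) := rfl
    rw [this, Nat.card_sum, Nat.card_prod, Nat.card_fin]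
    rfl
  have h2 : (Finset.univ : Finset G.V).card • 3 = 2 * G.graph.edgeFinset.card := by
    rw [← G.graph.sum_degrees_eq_twice_card_edges]
    exact (Finset.sum_eq_card_nsmul fun v _ => by convert hreg v).symm
  have h4 : Nat.card G.graph.edgeSet = G.graph.edgeFinset.card := by
    rw [Nat.card_eq_fintype_card, SimpleGraph.edgeFinset_card]
  have h5 : Fintype.card G.V = G.order := Nat.card_eq_fintype_card.symm
  rw [h1, h4]
  rw [Finset.card_univ, h5, smul_eq_mul] at h2
  calc 2 * (G.order + G.graph.edgeFinset.card * k)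
      = 2 * G.order + 2 * G.graph.edgeFinset.card * k := by ring
    _ = _ := by rw [← h2]; ring

/-- In a cubic graph, at most `1 + 3 * k` vertices of the subdivision have a given base point. -/
theorem ncard_preimage_basePoint_le [Fintype G.V] [G.graph.LocallyFinite]
    (hreg : G.graph.IsRegularOfDegree 3) {A : Set (G.subdivide k).V} {W : Set G.V}
    (hAW : ∀ y ∈ A, basePoint G k y ∈ W) : A.ncard ≤ (1 + 3 * k) * W.ncard := by
  classical
  have : Fintype (G.subdivide k).V := Fintype.ofFinite _
  rw [Set.ncard_eq_toFinset_card', Set.ncard_eq_toFinset_card']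
  refine Finset.card_le_mul_card_image_of_maps_to (f := basePoint G k)
    (fun y hy => Set.mem_toFinset.2 (hAW y (Set.mem_toFinset.1 hy))) _ fun v _ => ?_
  let E : Finset G.graph.edgeSet := {e | v ∈ e.1}
  have hE : E.card ≤ 3 := by
    rw [← hreg v, ← SimpleGraph.card_incidenceFinset_eq_degree]
    refine Finset.card_le_card_of_injOn Subtype.val ?_ Subtype.val_injective.injOn
    intro e he
    simp only [E, Finset.coe_filter_univ, Set.mem_ofPred_eq] at he
    simpa [SimpleGraph.mem_incidenceFinset, SimpleGraph.incidenceSet] using he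
  let R : Finset (G.subdivide k).V :=
    {Sum.inl v} ∪ (E ×ˢ (Finset.univ : Finset (Fin k))).image Sum.inr
  have hsub : (A.toFinset.filter fun y => basePoint G k y = v) ⊆ R := by
    intro y hy
    have hy := (Finset.mem_filter.1 hy).2
    rcases y with a | ⟨e, i⟩
    · exact Finset.mem_union_left _ (Finset.mem_singleton.2 (congrArg Sum.inl hy))
    · refine Finset.mem_union_right _ (Finset.mem_image.2 ⟨(e, i), ?_, rfl⟩)
      refine Finset.mem_product.2 ⟨(Finset.mem_filter_univ _).2 ?_, Finset.mem_univ _⟩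
      rw [← hy]
      exact Sym2.out_fst_mem e.1
  refine (Finset.card_le_card hsub).trans ((Finset.card_union_le _ _).trans ?_)
  refine Nat.add_le_add (Finset.card_singleton _).le (Finset.card_image_le.trans ?_)
  rw [Finset.card_product, Finset.card_univ, Fintype.card_fin]
  exact Nat.mul_le_mul_right _ hE

theorem adj_subdivide_fst {e : G.graph.edgeSet} {i : Fin k} (h : (i : ℕ) = 0) :
    (G.subdivide k).graph.Adj (.inl (Quot.out e.1).1) (.inr (e, i)) :=
  (SimpleGraph.fromRel_adj _ _ _).2 ⟨Sum.inl_ne_inr, Or.inl (Or.inl ⟨h, rfl⟩)⟩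

theorem adj_subdivide_snd {e : G.graph.edgeSet} {i : Fin k} (h : (i : ℕ) + 1 = k) :
    (G.subdivide k).graph.Adj (.inl (Quot.out e.1).2) (.inr (e, i)) :=
  (SimpleGraph.fromRel_adj _ _ _).2 ⟨Sum.inl_ne_inr, Or.inl (Or.inr ⟨h, rfl⟩)⟩

theorem adj_subdivide_inner {e : G.graph.edgeSet} {i j : Fin k} (h : (i : ℕ) + 1 = j) :
    (G.subdivide k).graph.Adj (.inr (e, i)) (.inr (e, j)) := by
  refine (SimpleGraph.fromRel_adj _ _ _).2 ⟨fun h' => ?_, Or.inl ⟨rfl, h⟩⟩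
  have h1 := (Prod.ext_iff.1 (Sum.inr_injective h')).2
  simp only at h1
  rw [h1] at h
  omega

/-- A balanced separator of a subdivision projects to a set `U` of vertices of the cubic graph,
and the two-colouring it induces on the branch vertices has two large colour classes. -/
theorem le_sep_subdivide_of_expansion [Fintype G.V] [G.graph.LocallyFinite] {M : ℕ}
    (hreg : G.graph.IsRegularOfDegree 3) (hexp : HasLargeSetExpansion G.graph M)
    (horder : G.order = 400 * M) (hk : 0 < k) : M ≤ 100 * (G.subdivide k).sep := by
  obtain ⟨X, hX, hXcard⟩ := (G.subdivide k).exists_ncard_eq_sep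
  obtain ⟨γ, hγ, hlarge⟩ := hX.exists_coloring
  rw [← hXcard]
  let U : Set G.V := basePoint G k '' X
  have hU : U.ncard ≤ X.ncard := Set.ncard_image_le
  have hinl : ∀ v, v ∉ U → (Sum.inl v : (G.subdivide k).V) ∉ X := fun v hv h => hv ⟨_, h, rfl⟩
  have hinr : ∀ (e : G.graph.edgeSet) (i : Fin k), (Quot.out e.1).1 ∉ U →
      (Sum.inr (e, i) : (G.subdivide k).V) ∉ X := fun e i hv h => hv ⟨_, h, rfl⟩
  have hpath : ∀ (e : G.graph.edgeSet), (Quot.out e.1).1 ∉ U → ∀ (i : ℕ) (hi : i < k),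
      γ (.inr (e, ⟨i, hi⟩)) = γ (.inl (Quot.out e.1).1) := by
    intro e he i
    induction i with
    | zero => exact fun hi => (hγ _ _ (adj_subdivide_fst rfl) (hinl _ he) (hinr _ _ he)).symm
    | succ i ih =>
      intro hi
      rw [← ih (Nat.lt_of_succ_lt hi)]
      exact (hγ _ _ (adj_subdivide_inner rfl) (hinr _ _ he) (hinr _ _ he)).symm
  refine hexp U (fun v => γ (.inl v)) X.ncard hU ?_ ?_
  · intro u v huv hu hv
    have hedge : ∀ e : G.graph.edgeSet, (Quot.out e.1).1 ∉ U → (Quot.out e.1).2 ∉ U →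
        γ (.inl (Quot.out e.1).1) = γ (.inl (Quot.out e.1).2) := by
      intro e h1 h2
      rw [← hpath e h1 (k - 1) (by omega)]
      refine (hγ _ _ (adj_subdivide_snd ?_) (hinl _ h2) (hinr _ _ h1)).symm
      simp only
      omega
    have h := hedge ⟨s(u, v), huv⟩
    have h' : s((Quot.out s(u, v)).1, (Quot.out s(u, v)).2) = s(u, v) := Quot.out_eq s(u, v)
    rcases Sym2.eq_iff.1 h' with ⟨h1, h2⟩ | ⟨h1, h2⟩
    · simp only [h1, h2] at h
      exact h hu hv
    · simp only [h1, h2] at h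
      exact (h hv hu).symm
  · intro b
    have h1 : {y | y ∉ X ∧ γ y = b}.ncard
        ≤ (1 + 3 * k) * ({v | γ (.inl v) = b} ∪ U).ncard := by
      refine ncard_preimage_basePoint_le hreg ?_
      rintro y ⟨hyX, hy⟩
      by_cases hyU : basePoint G k y ∈ U
      · exact Or.inr hyU
      · refine Or.inl ?_
        rcases y with v | ⟨e, i⟩
        · exact hy
        · exact (hpath e hyU i i.2).symm.trans hy
    have h2 := Set.ncard_union_le {v | γ (.inl v) = b} U
    have h3 := two_mul_order_subdivide (k := k) hreg
    have h4 := hlarge b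
    have h5 : {y | y ∉ X ∧ γ y = b}.ncard
        ≤ (1 + 3 * k) * ({v | γ (.inl v) = b}.ncard + X.ncard) :=
      h1.trans (Nat.mul_le_mul_left _ (by omega))
    rw [← horder]
    -- The order `m` of `G` and `n` of the subdivision satisfy `2 n = m (2 + 3 k) ≥ m (1 + 3 k)`,
    -- so the factor `1 + 3 k` cancels.
    refine Nat.le_of_mul_le_mul_left ?_ (show 0 < 1 + 3 * k by omega)
    nlinarith [Nat.zero_le (k * X.ncard)]

end Cubic

end FinGraph

theorem HasLargeSetExpansion.of_iso {V W : Type*} {G : SimpleGraph V} {H : SimpleGraph W} {M : ℕ}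
    (f : G ≃g H) (h : HasLargeSetExpansion H M) : HasLargeSetExpansion G M := by
  intro U c x hU hc hlarge
  have hcard : ∀ s : Set V, (f.symm ⁻¹' s).ncard = s.ncard := by
    intro s
    rw [← Nat.card_coe_set_eq, ← Nat.card_coe_set_eq]
    exact Nat.card_congr (f.symm.toEquiv.subtypeEquiv fun _ => Iff.rfl)
  refine h (f.symm ⁻¹' U) (fun w => c (f.symm w)) x ((hcard U).trans_le hU) ?_ fun b => ?_
  · exact fun u v huv => hc _ _ (f.symm.map_adj_iff.2 huv)
  · exact (hlarge b).trans_eq (by rw [← hcard {v | c v = b}]; rfl)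

/-! ### Asymptotics -/

namespace GraphClass

/-- If `|V(G)| ≤ n ^ (1 - ε)`, the branch vertices are few; otherwise each subdivided edge has at
least `n ^ ε` inner vertices, so at most `n ^ (1 - ε)` of them lie completely in `H`. -/
theorem sep_le_of_mem_powSubdivide {𝒢 : GraphClass.{u}} {ε : ℝ} (hε₀ : 0 < ε) (hε₁ : ε < 1)
    {H : FinGraph.{u}} (hH : H ∈ 𝒢.powSubdivide ε) {n : ℕ} (hn : H.order ≤ n) :
    (H.sep : ℝ) ≤ (n : ℝ) ^ (1 - ε) + 3 := by
  obtain ⟨G, -, ⟨f⟩⟩ := hH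
  have hδ : 0 < 1 - ε := by linarith
  have hpos : (0 : ℝ) ≤ (n : ℝ) ^ (1 - ε) := by positivity
  rcases Nat.eq_zero_or_pos G.order with h0 | hm
  · have hG : IsEmpty G.V := by
      rcases Nat.card_eq_zero.1 h0 with h | h
      · exact h
      · exact absurd G.finite (not_finite_iff_infinite.2 h)
    have hH : IsEmpty H.V := by
      refine ⟨fun y => ?_⟩
      rcases f y with v | ⟨e, -⟩
      · exact hG.elim v
      · exact hG.elim (Quot.out e.1).1
    have h1 : H.sep = 0 := Nat.le_zero.1 (H.sep_le_order.trans_eq Nat.card_of_isEmpty)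
    rw [h1, Nat.cast_zero]
    linarith
  have hm' : (0 : ℝ) < G.order := by exact_mod_cast hm
  unfold FinGraph.powSubdivide at f
  set k := ⌈(G.order : ℝ) ^ (ε / (1 - ε))⌉₊ with hk_def
  have hk : 0 < k := Nat.ceil_pos.2 (by positivity)
  by_cases hlarge : ∃ e, 2 * H.order < 3 * (FinGraph.pathPart f e).ncard
  · obtain ⟨e, he⟩ := hlarge
    have h1 : (H.sep : ℝ) ≤ 3 := by
      exact_mod_cast FinGraph.sep_le_three_of_large_pathPart f hk e he
    linarith
  push Not at hlarge
  rcases le_total (G.order : ℝ) ((n : ℝ) ^ (1 - ε)) with hcase | hcase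
  · have h1 : (H.sep : ℝ) ≤ G.order := by
      exact_mod_cast FinGraph.sep_le_order_of_small_pathPart f hk hlarge
    linarith
  · obtain ⟨q, hq, hqk⟩ := FinGraph.sep_mul_le_of_small_pathPart f hk hlarge
    have h1 : (H.sep : ℝ) ≤ q + 1 := by exact_mod_cast hq
    have h2 : (n : ℝ) ^ ε ≤ k := by
      calc (n : ℝ) ^ ε = ((n : ℝ) ^ (1 - ε)) ^ (ε / (1 - ε)) := by
            rw [← Real.rpow_mul (Nat.cast_nonneg n), mul_div_cancel₀ _ hδ.ne']
        _ ≤ (G.order : ℝ) ^ (ε / (1 - ε)) :=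
            Real.rpow_le_rpow hpos hcase (div_nonneg hε₀.le hδ.le)
        _ ≤ k := Nat.le_ceil _
    rcases Nat.eq_zero_or_pos n with rfl | hnpos
    · have h3 : H.sep ≤ 0 := H.sep_le_order.trans hn
      have h4 : (H.sep : ℝ) ≤ 0 := by exact_mod_cast h3
      linarith
    have hn' : (0 : ℝ) < n := by exact_mod_cast hnpos
    have h3 : (q : ℝ) * k ≤ n := by exact_mod_cast hqk.trans hn
    have h4 : (q : ℝ) ≤ (n : ℝ) ^ (1 - ε) := by
      have h5 : (0 : ℝ) < (n : ℝ) ^ ε := by positivity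
      refine le_of_mul_le_mul_right ?_ h5
      calc (q : ℝ) * (n : ℝ) ^ ε ≤ q * k := by gcongr
        _ ≤ n := h3
        _ = (n : ℝ) ^ (1 - ε) * (n : ℝ) ^ ε := by
          rw [← Real.rpow_add hn', sub_add_cancel, Real.rpow_one]
    linarith

theorem maxSep_powSubdivide_le (𝒢 : GraphClass.{u}) {ε : ℝ} (hε₀ : 0 < ε) (hε₁ : ε < 1) (n : ℕ) :
    ((𝒢.powSubdivide ε).maxSep n : ℝ) ≤ (n : ℝ) ^ (1 - ε) + 3 := by
  by_cases h : ∃ H ∈ 𝒢.powSubdivide ε, H.order ≤ n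
  · obtain ⟨H, hH, hn, hs⟩ := (isGreatest_maxSep _ n h).1
    rw [← hs]
    exact sep_le_of_mem_powSubdivide hε₀ hε₁ hH hn
  · have h1 : (𝒢.powSubdivide ε).maxSep n = 0 := by
      have h2 : {k | ∃ G ∈ 𝒢.powSubdivide ε, G.order ≤ n ∧ G.sep = k} = ∅ := by
        refine Set.eq_empty_of_forall_notMem ?_
        rintro k ⟨H, hH, hn, -⟩
        exact h ⟨H, hH, hn⟩
      rw [maxSep, h2, csSup_empty]
      rfl
    rw [h1, Nat.cast_zero]
    positivity

/-- The class contains, for each `M > 0`, a cubic graph on `400 * M` vertices all of whose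
subdivisions have separation number at least `M / 100`. -/
theorem ContainsAllCubic.exists_expander {𝒢 : GraphClass.{u}} (h𝒢 : 𝒢.ContainsAllCubic) {M : ℕ}
    (hM : 0 < M) : ∃ G ∈ 𝒢, G.order = 400 * M ∧ ∀ k, 0 < k →
      2 * (G.subdivide k).order = G.order * (2 + 3 * k) ∧ M ≤ 100 * (G.subdivide k).sep := by
  classical
  obtain ⟨π, hπ⟩ := exists_blockGraph_expansion hM
  let V := ULift.{u} (BlockVertex M)
  let B : SimpleGraph V := (blockGraph π).comap (Equiv.ulift : V ≃ BlockVertex M)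
  let g : B ≃g blockGraph π := SimpleGraph.Iso.comap Equiv.ulift (blockGraph π)
  have hreg : ∀ {W : Type u} [Fintype W] (K : SimpleGraph W) [K.LocallyFinite]
      (_ : K ≃g blockGraph π), K.IsRegularOfDegree 3 := by
    intro W _ K _ φ v
    rw [← blockGraph_isRegular π (φ v)]
    exact (φ.degree_eq v).symm
  have : Fintype V := inferInstance
  obtain ⟨G, hG, ⟨φ⟩⟩ := h𝒢 V B (hreg B g)
  have : Fintype G.V := Fintype.ofFinite _
  let ψ : G.graph ≃g blockGraph π := φ.symm.trans g
  have hGreg := hreg G.graph ψ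
  have horder : G.order = 400 * M := by
    have h1 : G.order = Nat.card (BlockVertex M) := Nat.card_congr ψ.toEquiv
    rw [h1, Nat.card_eq_fintype_card, Fintype.card_prod, Fintype.card_prod, Fintype.card_bool,
      Fintype.card_fin, ZMod.card]
    ring
  exact ⟨G, hG, horder, fun k hk => ⟨FinGraph.two_mul_order_subdivide hGreg,
    FinGraph.le_sep_subdivide_of_expansion hGreg (hπ.of_iso ψ) horder hk⟩⟩

/-- With `M = ⌊n ^ (1 - ε) / 1600⌋`, the expander on `400 * M ≤ n ^ (1 - ε) / 4` vertices has its
edges subdivided at most `2 * n ^ ε` times, so its subdivision has at most `n` vertices. -/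
theorem ContainsAllCubic.rpow_le_maxSep {𝒢 : GraphClass.{u}} (h𝒢 : 𝒢.ContainsAllCubic) {ε : ℝ}
    (hε₀ : 0 < ε) (hε₁ : ε < 1) {n : ℕ} (hn : 1600 ≤ (n : ℝ) ^ (1 - ε)) :
    (n : ℝ) ^ (1 - ε) ≤ 320000 * ((𝒢.powSubdivide ε).maxSep n : ℝ) := by
  have hδ : 0 < 1 - ε := by linarith
  have hn0 : n ≠ 0 := by
    rintro rfl
    rw [Nat.cast_zero, Real.zero_rpow hδ.ne'] at hn
    norm_num at hn
  have hn1 : (1 : ℝ) ≤ n := by exact_mod_cast Nat.one_le_iff_ne_zero.2 hn0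
  set a := (n : ℝ) ^ (1 - ε) with ha
  set M := ⌊a / 1600⌋₊ with hM_def
  have hM : 0 < M := Nat.floor_pos.2 (by rw [le_div_iff₀] <;> linarith)
  have hM1 : (1 : ℝ) ≤ M := by exact_mod_cast hM
  have hMle : (M : ℝ) ≤ a / 1600 := Nat.floor_le (by linarith)
  have hMge : a / 1600 < M + 1 := Nat.lt_floor_add_one _
  obtain ⟨G, hG, horder, hsep⟩ := h𝒢.exists_expander hM
  have horderR : (G.order : ℝ) = 400 * M := by rw [horder]; push_cast; ring
  set k := ⌈(G.order : ℝ) ^ (ε / (1 - ε))⌉₊ with hk_def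
  have hGpos : (0 : ℝ) < G.order := by rw [horderR]; linarith
  have hk : 0 < k := Nat.ceil_pos.2 (by positivity)
  obtain ⟨h2, hMsep⟩ := hsep k hk
  have hnε : (1 : ℝ) ≤ (n : ℝ) ^ ε := Real.one_le_rpow hn1 hε₀.le
  have hk_le : (k : ℝ) ≤ 2 * (n : ℝ) ^ ε := by
    have h3 : (G.order : ℝ) ^ (ε / (1 - ε)) ≤ (n : ℝ) ^ ε := by
      calc (G.order : ℝ) ^ (ε / (1 - ε)) ≤ a ^ (ε / (1 - ε)) :=
            Real.rpow_le_rpow hGpos.le (by rw [horderR]; linarith) (div_nonneg hε₀.le hδ.le)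
        _ = (n : ℝ) ^ ε := by
          rw [ha, ← Real.rpow_mul (Nat.cast_nonneg n), mul_div_cancel₀ _ hδ.ne']
    have h4 := Nat.ceil_lt_add_one (a := (G.order : ℝ) ^ (ε / (1 - ε))) (by positivity)
    linarith
  have hΓ : (G.subdivide k).order ≤ n := by
    have h3 : 2 * ((G.subdivide k).order : ℝ) = G.order * (2 + 3 * k) := by exact_mod_cast h2
    have h4 : a * (n : ℝ) ^ ε = n := by
      rw [ha, ← Real.rpow_add (by linarith), sub_add_cancel, Real.rpow_one]
    have h5 : (G.order : ℝ) * (2 + 3 * k) ≤ a / 4 * (8 * (n : ℝ) ^ ε) := by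
      refine mul_le_mul (by rw [horderR]; linarith) (by linarith) (by positivity) (by linarith)
    have h6 : ((G.subdivide k).order : ℝ) ≤ n := by linarith
    exact_mod_cast h6
  have hmem : G.subdivide k ∈ 𝒢.powSubdivide ε := ⟨G, hG, ⟨SimpleGraph.Embedding.refl⟩⟩
  have hmax : (G.subdivide k).sep ≤ (𝒢.powSubdivide ε).maxSep n :=
    (isGreatest_maxSep _ n ⟨_, hmem, hΓ⟩).2 ⟨_, hmem, hΓ, rfl⟩
  have h7 : (M : ℝ) ≤ 100 * ((𝒢.powSubdivide ε).maxSep n : ℝ) := by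
    exact_mod_cast hMsep.trans (Nat.mul_le_mul_left _ hmax)
  linarith

end GraphClass

theorem mainTheorem5 (𝒢 : GraphClass.{u}) (ε : ℝ) (hε₀ : 0 < ε) (hε₁ : ε < 1) :
    ((fun n : ℕ => ((𝒢.powSubdivide ε).maxSep n : ℝ)) =O[atTop] fun n : ℕ => (n : ℝ) ^ (1 - ε)) ∧
    (𝒢.ContainsAllCubic →
      (fun n : ℕ => (n : ℝ) ^ (1 - ε)) =O[atTop]
        fun n : ℕ => ((𝒢.powSubdivide ε).maxSep n : ℝ)) := by
  have hδ : 0 < 1 - ε := by linarith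
  refine ⟨IsBigO.of_bound 4 ?_, fun h𝒢 => IsBigO.of_bound 320000 ?_⟩
  · filter_upwards [eventually_ge_atTop 1] with n hn
    have h1 : (1 : ℝ) ≤ (n : ℝ) ^ (1 - ε) := Real.one_le_rpow (by exact_mod_cast hn) hδ.le
    rw [Real.norm_of_nonneg (by positivity), Real.norm_of_nonneg (by positivity)]
    linarith [GraphClass.maxSep_powSubdivide_le 𝒢 hε₀ hε₁ n]
  · have h1 : Tendsto (fun n : ℕ => (n : ℝ) ^ (1 - ε)) atTop atTop :=
      (tendsto_rpow_atTop hδ).comp tendsto_natCast_atTop_atTop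
    filter_upwards [h1.eventually_ge_atTop 1600] with n hn
    rw [Real.norm_of_nonneg (by positivity), Real.norm_of_nonneg (by positivity)]
    exact h𝒢.rpow_le_maxSep hε₀ hε₁ hn
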